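/- Let $\{d_k\}_{k\ge1}$ be positive rational numbers, $d_k=l_k/t_k$ with positive integers $l_k,t_k$ (not necessarily coprime), and let $\{\gamma_k\}_{k\ge1}$ be positive integers; assume that $\{t_k\}$ and $\{\gamma_k\}$ are bounded. For a finite nonempty set $A\subset\mathbb R$ put $\delta_A=\frac1{\#A}\sum_{a\in A}\delta_a$, where $\delta_a$ is the Dirac measure at $a$. Suppose that the finite convolutions $\delta_{d_1^{-1}\{0,\dots,\gamma_1-1\}}*\cdots*\delta_{(d_1\cdots d_n)^{-1}\{0,\dots,\gamma_n-1\}}$ converge weakly, as $n\to\infty$, to a Borel probability measure $$\nu=\delta_{d_1^{-1}\{0,\dots,\gamma_1-1\}}*\delta_{(d_1d_2)^{-1}\{0,\dots,\gamma_2-1\}}*\cdots$$ on $\mathbb R$, and that $\nu$ is a spectral measure, that is, $\nu$ is compactly supported and there is a countable set $\Lambda\subset\mathbb R$ such that $\{e^{2\pi i\lambda x}:\lambda\in\Lambda\}$ is an orthonormal basis of $L^2(\nu)$. Then the following hold for every $i\ge1$. (i) If $\gamma_i\nmid t_{i+1}$, then $\gamma_{i+1}\mid l_{i+1}$. (ii)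 If $\gamma_i\nmid t_{i+1}$, $\gamma_{i+1}\ge2$, $\gcd(l_{i+1},t_{i+1})=1$, and $d_{i+2}=l_{i+2}$ is an integer with $t_{i+1}\mid l_{i+2}$, then $t_{i+1}\gamma_{i+2}\mid l_{i+2}$. -/

import Mathlib

open MeasureTheory Filter Topology
open scoped ENNReal BoundedContinuousFunction

/-- The uniform probability measure `δ_A = (1 / #A) ∑_{a ∈ A} δ_a` on a finite set `A` of reals. -/
noncomputable def uniformDirac (A : Finset ℝ) : Measure ℝ :=
  (A.card : ℝ≥0∞)⁻¹ • ∑ a ∈ A, Measure.dirac a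

/-- The finite convolution `μ 0 ∗ ⋯ ∗ μ (n - 1)` (the unit `δ_0` for `n = 0`). -/
noncomputable def finiteConv (μ : ℕ → Measure ℝ) : ℕ → Measure ℝ
  | 0 => Measure.dirac 0
  | n + 1 => Measure.conv (finiteConv μ n) (μ n)

/-- `ν` is the infinite convolution `μ 0 ∗ μ 1 ∗ ⋯`: the finite convolutions converge weakly to the
probability measure `ν`. -/
def IsInfiniteConv (μ : ℕ → Measure ℝ) (ν : Measure ℝ) : Prop :=
  IsProbabilityMeasure ν ∧ ∀ f : ℝ →ᵇ ℝ,
    Tendsto (fun n => ∫ x, f x ∂(finiteConv μ n)) atTop (𝓝 (∫ x, f x ∂ν))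

/-- The set `(d_0 d_1 ⋯ d_k)⁻¹ {0, 1, …, γ_k - 1}`. Sequences are indexed from `0`. -/
noncomputable def moranDigits (d : ℕ → ℚ) (γ : ℕ → ℕ) (k : ℕ) : Finset ℝ :=
  (Finset.range (γ k)).image fun j : ℕ =>
    (∏ m ∈ Finset.range (k + 1), (d m : ℝ))⁻¹ * (j : ℝ)

/-- `ν` is the infinite convolution of the measures `δ_{(d_0 ⋯ d_k)⁻¹ {0, …, γ_k - 1}}`. -/
def IsMoranMeasure (d : ℕ → ℚ) (γ : ℕ → ℕ) (ν : Measure ℝ) : Prop :=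
  IsInfiniteConv (fun k => uniformDirac (moranDigits d γ k)) ν

/-- The exponential function `x ↦ e^{2 π i a x}`. -/
noncomputable def expFun (a x : ℝ) : ℂ :=
  Complex.exp (2 * Real.pi * Complex.I * a * x)

theorem memLp_expFun (μ : Measure ℝ) [IsFiniteMeasure μ] (a : ℝ) : MemLp (expFun a) 2 μ := by
  refine MemLp.of_bound (C := 1) ?_ (Filter.Eventually.of_forall fun x => ?_)
  · have h : Continuous (expFun a) := by
      unfold expFun
      fun_prop
    exact h.aestronglyMeasurable
  · have h : (2 * Real.pi * Complex.I * a * x : ℂ) = ((2 * Real.pi * a * x : ℝ) : ℂ) * Complex.I := by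
      push_cast
      ring
    rw [expFun, h, Complex.norm_exp_ofReal_mul_I]

/-- The exponential `e^{2 π i a x}` as an element of `L²(μ)`. -/
noncomputable def expL2 (μ : Measure ℝ) [IsFiniteMeasure μ] (a : ℝ) : Lp ℂ 2 μ :=
  (memLp_expFun μ a).toLp (expFun a)

/-- `Λ` is a spectrum of `μ`: it is countable and the exponentials `e^{2 π i a x}`, `a ∈ Λ`, form an
orthonormal (Hilbert) basis of `L²(μ)`. -/
def IsSpectrum (μ : Measure ℝ) [IsFiniteMeasure μ] (Λ : Set ℝ) : Prop :=
  Λ.Countable ∧ ∃ b : HilbertBasis Λ ℂ (Lp ℂ 2 μ), ∀ a : Λ, b a = expL2 μ a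

/-- A spectral measure: a compactly supported Borel probability measure that has a spectrum. -/
def IsSpectralMeasure (μ : Measure ℝ) : Prop :=
  ∃ _ : IsProbabilityMeasure μ, IsCompact μ.support ∧ ∃ Λ : Set ℝ, IsSpectrum μ Λ

open scoped ComplexConjugate

/-! Pulling two digit factors out of the convolution exhibits `ν` as the average of the translates
of a probability measure `ρ` by `u j + v k`, with `j < γ` and `k < γ'`. The crux,
`IsTranslateAverage.dvd_of_spectrum`, is that `u t = v l` forces `γ ∣ t` or `γ' ∣ l`.

Spectrality makes the translates live on disjoint sets. Parseval gives every translate the same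
density in its own coordinates (`rnDeriv_add_ae_eq`), and a sweep from the left end of the support
shows that this density is constant (`rnDeriv_eq_card_of_spectrum`). Functions on the translates can
then be prescribed independently, so Parseval holds with the two digit masks taken at independent
phases `θ`, `η` (`tsum_mask`).

Suppose both divisibilities fail, and let `a₀` be in the spectrum; write `e_a` for `expFun a`.
Shifting the phase of the second mask by `1 / (γ' v)` produces `b` in the spectrum with `z = ∫ e_{a₀
- b} dρ ≠ 0` and `a₀ - b` in `(γ' v)⁻¹ ℤ` but not in `(γ u)⁻¹ ℤ`. When the first phase is shifted
instead, only those `a` contribute for which `a₀ - a` lies in the first-factor group `(γ u)⁻¹ ℤ` but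
not in `(γ' v)⁻¹ ℤ`. Then `b - a` lies in neither group, and orthogonality in `L²(ν)` makes `e_a`
and `e_b` orthogonal in `L²(ρ)`. Hence `e_{a₀} - z e_b` has a Parseval sum at least that of
`e_{a₀}`, although its squared norm is `1 - |z|² < 1`.

Part (i) is the case of consecutive factors. Part (ii) uses the pairs `(i + 1, i + 2)` and `(i, i +
2)` with `t = 1` and combines the results by coprimality. -/

/-! ### Exponentials and Parseval's identity -/

theorem expFun_eq (a x : ℝ) :
    expFun a x = Complex.exp ((2 * Real.pi * a * x : ℝ) * Complex.I) := by
  rw [expFun]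
  congr 1
  push_cast
  ring

theorem norm_expFun (a x : ℝ) : ‖expFun a x‖ = 1 := by
  rw [expFun_eq, Complex.norm_exp_ofReal_mul_I]

theorem enorm_expFun (a x : ℝ) : ‖expFun a x‖ₑ = 1 := by
  rw [← ofReal_norm, norm_expFun, ENNReal.ofReal_one]

theorem continuous_expFun (a : ℝ) : Continuous (expFun a) := by
  unfold expFun
  fun_prop

theorem expFun_add_right (a x y : ℝ) : expFun a (x + y) = expFun a x * expFun a y := by
  simp only [expFun, ← Complex.exp_add]
  congr 1
  push_cast
  ring

theorem expFun_add_left (a b x : ℝ) : expFun (a + b) x = expFun a x * expFun b x := by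
  simp only [expFun, ← Complex.exp_add]
  congr 1
  push_cast
  ring

theorem conj_expFun (a x : ℝ) : conj (expFun a x) = expFun (-a) x := by
  rw [expFun_eq, expFun_eq, ← Complex.exp_conj, map_mul, Complex.conj_ofReal,
    Complex.conj_I]
  congr 1
  push_cast
  ring

/-- The Parseval identity for a spectrum, in `ℝ≥0∞`. -/
theorem IsSpectrum.tsum_enorm_sq {μ : Measure ℝ} [IsFiniteMeasure μ] {Λ : Set ℝ}
    (h : IsSpectrum μ Λ) {f : ℝ → ℂ} (hf : MemLp f 2 μ) :
    ∑' a : Λ, ‖∫ x, conj (expFun a x) * f x ∂μ‖ₑ ^ 2 = ∫⁻ x, ‖f x‖ₑ ^ 2 ∂μ := by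
  obtain ⟨-, b, hb⟩ := h
  have hcoef : ∀ a : Λ, inner ℂ (b a) (hf.toLp f) = ∫ x, conj (expFun a x) * f x ∂μ := by
    intro a
    rw [hb, expL2, L2.inner_def]
    refine integral_congr_ae ?_
    filter_upwards [(memLp_expFun μ a).coeFn_toLp, hf.coeFn_toLp] with x h1 h2
    rw [h1, h2, RCLike.inner_apply, mul_comm]
  have hs : HasSum (fun a : Λ => ‖∫ x, conj (expFun a x) * f x ∂μ‖ ^ 2) (‖hf.toLp f‖ ^ 2) := by
    have := b.hasSum_inner_mul_inner (hf.toLp f) (hf.toLp f)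
    rw [inner_self_eq_norm_sq_to_K] at this
    have h2 := RCLike.hasSum_re ℂ this
    convert h2 using 1
    · ext a
      rw [← inner_conj_symm, ← hcoef, mul_comm, RCLike.mul_conj]
      norm_cast
    · norm_cast
  have h1 : ∑' a : Λ, ‖∫ x, conj (expFun a x) * f x ∂μ‖ₑ ^ 2
      = ENNReal.ofReal (‖hf.toLp f‖ ^ 2) := by
    rw [← hs.tsum_eq, ENNReal.ofReal_tsum_of_nonneg (fun _ => by positivity) hs.summable]
    refine tsum_congr fun a => ?_
    rw [ENNReal.ofReal_pow (norm_nonneg _), ofReal_norm]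
  rw [h1, Lp.norm_toLp, ENNReal.ofReal_pow ENNReal.toReal_nonneg,
    ENNReal.ofReal_toReal hf.eLpNorm_ne_top,
    eLpNorm_eq_lintegral_rpow_enorm_toReal (by norm_num) (by norm_num)]
  simp only [ENNReal.toReal_ofNat, ENNReal.rpow_ofNat]
  rw [← ENNReal.rpow_natCast, ← ENNReal.rpow_mul]
  norm_num

/-! ### Densities of translates in a spectral average -/

/-- `ν` is the average of the translates of `ρ` by the shifts `s i`. -/
def IsTranslateAverage {ι : Type*} [Fintype ι] (ν ρ : Measure ℝ) (s : ι → ℝ) : Prop :=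
  ν = (Fintype.card ι : ℝ≥0∞)⁻¹ • ∑ i, ρ.map (· + s i)

namespace IsTranslateAverage

variable {ι : Type*} [Fintype ι] {ν ρ : Measure ℝ} {s : ι → ℝ}

theorem lintegral_eq (h : IsTranslateAverage ν ρ s) {f : ℝ → ℝ≥0∞} (hf : Measurable f) :
    ∫⁻ x, f x ∂ν = (Fintype.card ι : ℝ≥0∞)⁻¹ * ∑ i, ∫⁻ y, f (y + s i) ∂ρ := by
  rw [h, lintegral_smul_measure, lintegral_finsetSum_measure, smul_eq_mul]
  congr 1
  refine Finset.sum_congr rfl fun i _ => ?_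
  rw [lintegral_map hf (by fun_prop)]

theorem integral_eq [Nonempty ι] [IsFiniteMeasure ρ] (h : IsTranslateAverage ν ρ s)
    {f : ℝ → ℂ} (hf : Measurable f) {C : ℝ} (hC : ∀ x, ‖f x‖ ≤ C) :
    ∫ x, f x ∂ν = (Fintype.card ι : ℂ)⁻¹ * ∑ i, ∫ y, f (y + s i) ∂ρ := by
  rw [h, integral_smul_measure, integral_finsetSum_measure]
  · rw [ENNReal.toReal_inv, ENNReal.toReal_natCast, Complex.real_smul]
    push_cast
    congr 1
    refine Finset.sum_congr rfl fun i _ => ?_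
    rw [integral_map (by fun_prop) hf.aestronglyMeasurable]
  · intro i _
    have : IsFiniteMeasure (ρ.map (· + s i)) := inferInstance
    exact Integrable.of_bound hf.aestronglyMeasurable C (Eventually.of_forall hC)

theorem sum_map_eq [Nonempty ι] (h : IsTranslateAverage ν ρ s) :
    ∑ i, ρ.map (· + s i) = (Fintype.card ι : ℝ≥0∞) • ν := by
  rw [h, smul_smul, ENNReal.mul_inv_cancel (by simp) (by simp), one_smul]

/-- One summand is at most the whole sum. Besides absolute continuity, the case of shift zero later
transfers tightness from convolutions to their cofactors. -/
theorem map_le [Nonempty ι] (h : IsTranslateAverage ν ρ s) (i : ι) :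
    ρ.map (· + s i) ≤ (Fintype.card ι : ℝ≥0∞) • ν := by
  rw [← h.sum_map_eq]
  refine Measure.le_iff.2 fun E hE => ?_
  rw [Measure.finsetSum_apply]
  exact Finset.single_le_sum (f := fun i => (ρ.map (· + s i)) E) (fun _ _ => zero_le)
    (Finset.mem_univ i)

theorem map_absolutelyContinuous [Nonempty ι] (h : IsTranslateAverage ν ρ s) (i : ι) :
    ρ.map (· + s i) ≪ ν :=
  (Measure.absolutelyContinuous_of_le (h.map_le i)).trans Measure.smul_absolutelyContinuous

/-- The densities of the translates add up to the number of translates. -/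
theorem sum_rnDeriv [Nonempty ι] [IsFiniteMeasure ρ] [IsFiniteMeasure ν]
    (h : IsTranslateAverage ν ρ s) :
    ∀ᵐ x ∂ν, ∑ i, (ρ.map (· + s i)).rnDeriv ν x = Fintype.card ι := by
  refine ae_eq_of_forall_setLIntegral_eq_of_sigmaFinite
    (Finset.measurable_fun_sum _ fun i _ => Measure.measurable_rnDeriv _ _) measurable_const ?_
  intro E hE _
  rw [lintegral_finsetSum _ fun i _ => Measure.measurable_rnDeriv _ _, setLIntegral_const]
  simp_rw [fun i => Measure.setLIntegral_rnDeriv (h.map_absolutelyContinuous i) E]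
  have := congrArg (fun μ : Measure ℝ => μ E) h.sum_map_eq
  simpa [Measure.finsetSum_apply] using this

theorem rnDeriv_le [Nonempty ι] [IsFiniteMeasure ρ] [IsFiniteMeasure ν]
    (h : IsTranslateAverage ν ρ s) (i : ι) :
    ∀ᵐ x ∂ν, (ρ.map (· + s i)).rnDeriv ν x ≤ Fintype.card ι := by
  filter_upwards [h.sum_rnDeriv] with x hx
  rw [← hx]
  exact Finset.single_le_sum (f := fun i => (ρ.map (· + s i)).rnDeriv ν x) (fun _ _ => zero_le)
    (Finset.mem_univ i)

/-- If the average of translates is spectral, each translate has the same density seen from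
its own origin. -/
theorem rnDeriv_add_ae_eq [Nonempty ι] [IsFiniteMeasure ρ] [IsFiniteMeasure ν]
    (h : IsTranslateAverage ν ρ s) {Λ : Set ℝ} (hΛ : IsSpectrum ν Λ) (i j : ι) :
    ∀ᵐ y ∂ρ, (ρ.map (· + s i)).rnDeriv ν (y + s i) = (ρ.map (· + s j)).rnDeriv ν (y + s j) := by
  have hm : ∀ i, Measurable fun y => (ρ.map (· + s i)).rnDeriv ν (y + s i) := fun i =>
    (Measure.measurable_rnDeriv _ _).comp (by fun_prop)
  refine ae_eq_of_forall_setLIntegral_eq_of_sigmaFinite (hm i) (hm j) ?_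
  intro E hE _
  -- The right side does not depend on `i`: a shift changes each Fourier coefficient only by a
  -- unimodular factor.
  suffices H : ∀ i, ∫⁻ y in E, (ρ.map (· + s i)).rnDeriv ν (y + s i) ∂ρ
      = ∑' a : Λ, ‖∫ y, conj (expFun a y) * E.indicator 1 y ∂ρ‖ₑ ^ 2 by rw [H i, H j]
  intro i
  set g := (ρ.map (· + s i)).rnDeriv ν with hg
  have hgm : Measurable g := Measure.measurable_rnDeriv _ _
  have hsm : Measurable fun x : ℝ => x - s i := by fun_prop
  -- Weighting by the density `g` turns integrals against `ν` into integrals against the `i`-th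
  -- translate; the second factor `g` in `|F|²` survives as the integrand.
  set F : ℝ → ℂ := fun x => E.indicator 1 (x - s i) * ((g x).toReal : ℂ) with hF
  have hind : Measurable fun x => (E.indicator 1 (x - s i) : ℂ) :=
    (measurable_const.indicator hE).comp hsm
  have hFm : Measurable F := hind.mul (Complex.measurable_ofReal.comp hgm.ennreal_toReal)
  have hlt : ∀ᵐ x ∂ν, g x < ∞ := Measure.rnDeriv_lt_top _ _
  have hFL : MemLp F 2 ν := by
    refine MemLp.of_bound (C := Fintype.card ι) hFm.aestronglyMeasurable ?_
    filter_upwards [h.rnDeriv_le i] with x hx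
    have h1 : (g x).toReal ≤ Fintype.card ι := by
      have := ENNReal.toReal_mono (by simp) hx
      simpa using this
    rw [hF, norm_mul, Complex.norm_real, Real.norm_of_nonneg ENNReal.toReal_nonneg]
    by_cases hx : x - s i ∈ E <;> simp [hx, h1]
  have hcoef : ∀ a : Λ, ‖∫ x, conj (expFun a x) * F x ∂ν‖ₑ ^ 2
      = ‖∫ y, conj (expFun a y) * E.indicator 1 y ∂ρ‖ₑ ^ 2 := by
    intro a
    have e1 : ∫ x, conj (expFun a x) * F x ∂ν
        = ∫ x, conj (expFun a x) * E.indicator 1 (x - s i) ∂(ρ.map (· + s i)) := by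
      rw [← integral_rnDeriv_smul (h.map_absolutelyContinuous i)]
      refine integral_congr_ae (Eventually.of_forall fun x => ?_)
      simp only [hF, Complex.real_smul, hg]
      ring
    have e2 : ∫ x, conj (expFun a x) * E.indicator 1 (x - s i) ∂(ρ.map (· + s i))
        = conj (expFun a (s i)) * ∫ y, conj (expFun a y) * E.indicator 1 y ∂ρ := by
      rw [integral_map (by fun_prop), ← integral_const_mul]
      · refine integral_congr_ae (Eventually.of_forall fun x => ?_)
        simp only [add_sub_cancel_right, expFun_add_right, map_mul]
        ring
      · exact ((Complex.continuous_conj.comp (continuous_expFun a)).measurable.mul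
          hind).aestronglyMeasurable
    rw [e1, e2, enorm_mul, conj_expFun, enorm_expFun, one_mul]
  rw [← tsum_congr hcoef, hΛ.tsum_enorm_sq hFL]
  have e3 : ∫⁻ x, ‖F x‖ₑ ^ 2 ∂ν
      = ∫⁻ x, g x * (E.indicator 1 (x - s i) * g x) ∂ν := by
    refine lintegral_congr_ae ?_
    filter_upwards [hlt] with x hx
    have : ‖((g x).toReal : ℂ)‖ₑ = g x := by
      rw [← ofReal_norm, Complex.norm_real, Real.norm_of_nonneg ENNReal.toReal_nonneg,
        ENNReal.ofReal_toReal hx.ne]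
    simp only [hF, enorm_mul, this]
    by_cases hx : x - s i ∈ E <;> simp [hx, sq]
  have hm2 : Measurable fun x => (E.indicator 1 (x - s i) : ℝ≥0∞) * g x :=
    ((measurable_const.indicator hE).comp hsm).mul hgm
  rw [e3, lintegral_rnDeriv_mul (h.map_absolutelyContinuous i) hm2.aemeasurable,
    lintegral_map hm2 (by fun_prop), ← lintegral_indicator hE]
  refine lintegral_congr fun y => ?_
  by_cases hy : y ∈ E <;> simp [hy]

end IsTranslateAverage

/-! ### Disjointness of the translates and Parseval with free coefficients -/

namespace IsTranslateAverage

variable {ι : Type*} [Fintype ι] {ν ρ : Measure ℝ} {s : ι → ℝ}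

/-- If the average of translates is spectral and one translate lies to the left of all others,
the density of that translate is constant. -/
theorem rnDeriv_eq_card_of_spectrum [Nonempty ι] [IsFiniteMeasure ρ] [IsFiniteMeasure ν]
    (h : IsTranslateAverage ν ρ s) {Λ : Set ℝ} (hΛ : IsSpectrum ν Λ) {m : ℝ}
    (hm : ν (Set.Iio m) = 0) {i₀ : ι} (hi₀ : s i₀ = 0) {δ : ℝ} (hδ : 0 < δ)
    (hs : ∀ i, i ≠ i₀ → δ ≤ s i) :
    ∀ᵐ y ∂ρ, (ρ.map (· + s i₀)).rnDeriv ν (y + s i₀) = Fintype.card ι := by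
  have hgm : ∀ i, Measurable ((ρ.map (· + s i)).rnDeriv ν) := fun i =>
    Measure.measurable_rnDeriv _ _
  have hback : ∀ (i : ι) {p : ℝ → Prop}, (∀ᵐ x ∂ν, p x) → ∀ᵐ y ∂ρ, p (y + s i) := fun i p hp =>
    ae_of_ae_map (by fun_prop) ((h.map_absolutelyContinuous i).ae_le hp)
  -- Sweep from the left end in steps of `δ`: a point reached from another translate comes from a
  -- `y` at least `δ` further left, where the density is already known.
  suffices H : ∀ n : ℕ, ∀ᵐ y ∂ρ, y < m + n * δ →
      (ρ.map (· + s i₀)).rnDeriv ν (y + s i₀) = Fintype.card ι by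
    filter_upwards [ae_all_iff.2 H] with y hy
    obtain ⟨n, hn⟩ := exists_nat_gt ((y - m) / δ)
    refine hy n ?_
    rw [div_lt_iff₀ hδ] at hn
    linarith
  intro n
  induction n with
  | zero =>
    have h1 : ∀ᵐ x ∂ν, ¬ x < m := by
      rw [ae_iff]
      simpa [Set.Iio] using hm
    filter_upwards [hback i₀ h1] with y hy hlt
    rw [hi₀] at hy
    norm_num at hlt hy
    exact absurd hlt (not_lt.2 hy)
  | succ n ih =>
    set r := m + n * δ with hr
    have h1 : ∀ i, i ≠ i₀ → ∀ᵐ x ∂ν, (ρ.map (· + s i)).rnDeriv ν x ≠ 0 → x < r + δ →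
        (ρ.map (· + s i)).rnDeriv ν x = Fintype.card ι := by
      -- Since the density is that of the `i`-th translate, a statement `ν`-a.e. where it is nonzero
      -- is a statement a.e. for that translate, hence about points `y + s i`.
      intro i hi
      rw [← ae_withDensity_iff (hgm i), Measure.withDensity_rnDeriv_eq _ _
        (h.map_absolutelyContinuous i), ae_map_iff (by fun_prop)]
      · filter_upwards [ih, h.rnDeriv_add_ae_eq hΛ i i₀] with y hy hy2 hlt
        rw [hy2]
        refine hy ?_
        linarith [hs i hi]
      · exact measurableSet_Iio.imp (hgm i (measurableSet_singleton _))
    have h2 : ∀ᵐ x ∂ν, ∀ i, i ≠ i₀ → (ρ.map (· + s i)).rnDeriv ν x ≠ 0 → x < r + δ →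
        (ρ.map (· + s i)).rnDeriv ν x = Fintype.card ι :=
      ae_all_iff.2 fun i => eventually_imp_distrib_left.2 (h1 i)
    have h3 : ∀ᵐ y ∂ρ, 0 < (ρ.map (· + s i₀)).rnDeriv ν (y + s i₀) :=
      ae_of_ae_map (f := (· + s i₀)) (p := fun x => 0 < (ρ.map (· + s i₀)).rnDeriv ν x)
        (by fun_prop) (Measure.rnDeriv_pos (h.map_absolutelyContinuous i₀))
    filter_upwards [hback i₀ h2, hback i₀ h.sum_rnDeriv, h3] with y hy hsum hpos hlt
    have hlt' : y + s i₀ < r + δ := by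
      rw [hi₀, hr]
      push_cast at hlt
      linarith
    -- Another nonzero density would already equal the total `card ι`, leaving no room for the
    -- positive density of the translate `i₀`.
    have hz : ∀ i, i ≠ i₀ → (ρ.map (· + s i)).rnDeriv ν (y + s i₀) = 0 := by
      classical
      intro i hi
      by_contra hne
      have h4 := hy i hi hne hlt'
      have h5 : ∑ k ∈ {i₀, i}, (ρ.map (· + s k)).rnDeriv ν (y + s i₀) ≤ Fintype.card ι := by
        rw [← hsum]
        exact Finset.sum_le_sum_of_subset (Finset.subset_univ _)
      rw [Finset.sum_pair hi.symm, h4] at h5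
      have h6 : ((Fintype.card ι : ℕ) : ℝ≥0∞) <
          (ρ.map (· + s i₀)).rnDeriv ν (y + s i₀) + Fintype.card ι := by
        rw [add_comm]
        exact ENNReal.lt_add_right (by simp) hpos.ne'
      exact absurd h5 (not_le.2 h6)
    rw [← hsum]
    exact (Finset.sum_eq_single i₀ (fun i _ hi => hz i hi) (by simp)).symm

/-- If the average of translates is spectral and one translate lies to the left of all others,
the translates live on disjoint sets. -/
theorem exists_disjoint_of_spectrum [Nonempty ι] [IsFiniteMeasure ρ] [IsFiniteMeasure ν]
    (h : IsTranslateAverage ν ρ s) {Λ : Set ℝ} (hΛ : IsSpectrum ν Λ) {m : ℝ}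
    (hm : ν (Set.Iio m) = 0) {i₀ : ι} (hi₀ : s i₀ = 0) {δ : ℝ} (hδ : 0 < δ)
    (hs : ∀ i, i ≠ i₀ → δ ≤ s i) :
    ∃ S : ι → Set ℝ, (∀ i, MeasurableSet (S i)) ∧
      ∀ᵐ y ∂ρ, ∀ i j, y + s i ∈ S j ↔ j = i := by
  classical
  refine ⟨fun j => {x | (ρ.map (· + s j)).rnDeriv ν x ≠ 0}, fun j =>
    Measure.measurable_rnDeriv _ _ (measurableSet_singleton _).compl, ?_⟩
  refine ae_all_iff.2 fun i => ?_
  filter_upwards [h.rnDeriv_eq_card_of_spectrum hΛ hm hi₀ hδ hs, h.rnDeriv_add_ae_eq hΛ i i₀,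
    ae_of_ae_map (by fun_prop) ((h.map_absolutelyContinuous i).ae_le h.sum_rnDeriv)]
    with y h1 h2 hsum j
  rw [h1] at h2
  constructor
  · intro hj
    by_contra hne
    have h5 : ∑ k ∈ {i, j}, (ρ.map (· + s k)).rnDeriv ν (y + s i) ≤ Fintype.card ι := by
      rw [← hsum]
      exact Finset.sum_le_sum_of_subset (Finset.subset_univ _)
    rw [Finset.sum_pair (Ne.symm hne), h2] at h5
    exact absurd h5 (not_le.2 (ENNReal.lt_add_right (by simp) hj))
  · rintro rfl
    show (ρ.map (· + s j)).rnDeriv ν (y + s j) ≠ 0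
    rw [h2]
    simp

/-- The Parseval identity for functions that are products in terms of translate and position. -/
theorem tsum_enorm_sq_eq [Nonempty ι] [IsFiniteMeasure ρ] [IsFiniteMeasure ν]
    (h : IsTranslateAverage ν ρ s) {Λ : Set ℝ} (hΛ : IsSpectrum ν Λ) {m : ℝ}
    (hm : ν (Set.Iio m) = 0) {i₀ : ι} (hi₀ : s i₀ = 0) {δ : ℝ} (hδ : 0 < δ)
    (hs : ∀ i, i ≠ i₀ → δ ≤ s i) (φ : ι → ℂ) {f : ℝ → ℂ} (hf : Measurable f) {C : ℝ}
    (hC : ∀ x, ‖f x‖ ≤ C) :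
    ∑' a : Λ, ‖(Fintype.card ι : ℂ)⁻¹ * ∑ i, φ i * conj (expFun a (s i))‖ₑ ^ 2 *
        ‖∫ y, conj (expFun a y) * f y ∂ρ‖ₑ ^ 2
      = (Fintype.card ι : ℝ≥0∞)⁻¹ * ∑ i, ‖φ i‖ₑ ^ 2 * ∫⁻ y, ‖f y‖ₑ ^ 2 ∂ρ := by
  classical
  obtain ⟨S, hS, hdis⟩ := h.exists_disjoint_of_spectrum hΛ hm hi₀ hδ hs
  -- By disjointness, `F` is well separated: on the `i`-th translate it is `φ i` times the copy of
  -- `f` there.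
  set F : ℝ → ℂ := fun x => ∑ i, (S i).indicator (fun x => φ i * f (x - s i)) x with hF
  have hFm : Measurable F := Finset.measurable_fun_sum _ fun i _ =>
    ((hf.comp (by fun_prop)).const_mul _).indicator (hS i)
  have hFC : ∀ x, ‖F x‖ ≤ ∑ i, ‖φ i‖ * C := by
    intro x
    refine (norm_sum_le _ _).trans (Finset.sum_le_sum fun i _ => ?_)
    refine (norm_indicator_le_norm_self _ _).trans ?_
    rw [norm_mul]
    exact mul_le_mul_of_nonneg_left (hC _) (norm_nonneg _)
  have hFv : ∀ᵐ y ∂ρ, ∀ i, F (y + s i) = φ i * f y := by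
    filter_upwards [hdis] with y hy i
    simp only [hF]
    rw [Finset.sum_eq_single i]
    · rw [Set.indicator_of_mem ((hy i i).2 rfl), add_sub_cancel_right]
    · intro j _ hj
      exact Set.indicator_of_notMem (fun hmem => hj ((hy i j).1 hmem)) _
    · simp
  have hcoef : ∀ a : Λ, ∫ x, conj (expFun a x) * F x ∂ν
      = ((Fintype.card ι : ℂ)⁻¹ * ∑ i, φ i * conj (expFun a (s i))) *
        ∫ y, conj (expFun a y) * f y ∂ρ := by
    intro a
    rw [h.integral_eq (C := ∑ i, ‖φ i‖ * C), mul_assoc, Finset.sum_mul]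
    · congr 1
      refine Finset.sum_congr rfl fun i _ => ?_
      rw [← integral_const_mul]
      refine integral_congr_ae ?_
      filter_upwards [hFv] with y hy
      rw [hy i, expFun_add_right, map_mul]
      ring
    · exact (Complex.continuous_conj.comp (continuous_expFun a)).measurable.mul hFm
    · intro x
      rw [norm_mul, conj_expFun, norm_expFun, one_mul]
      exact hFC x
  have hP := hΛ.tsum_enorm_sq (MemLp.of_bound hFm.aestronglyMeasurable _
    (Eventually.of_forall hFC))
  rw [h.lintegral_eq (hFm.enorm.pow_const 2)] at hP
  simp_rw [hcoef, enorm_mul _ (∫ y, conj (expFun _ y) * f y ∂ρ), mul_pow] at hP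
  rw [hP]
  congr 1
  refine Finset.sum_congr rfl fun i _ => ?_
  rw [← lintegral_const_mul _ (hf.enorm.pow_const 2)]
  refine lintegral_congr_ae ?_
  filter_upwards [hFv] with y hy
  rw [hy i, enorm_mul, mul_pow]

end IsTranslateAverage

/-! ### Zeros of the digit masks -/

/-- The normalized exponential sum `γ⁻¹ ∑_{j < γ} e^{2 π i x j}`. -/
noncomputable def digitMask (γ : ℕ) (x : ℝ) : ℂ :=
  (γ : ℂ)⁻¹ * ∑ j : Fin γ, expFun x (j : ℕ)

theorem expFun_one_eq_one_iff (x : ℝ) : expFun x 1 = 1 ↔ ∃ n : ℤ, x = n := by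
  rw [expFun, Complex.exp_eq_one_iff]
  have h2 : (2 * Real.pi * Complex.I : ℂ) ≠ 0 := Complex.two_pi_I_ne_zero
  constructor
  · rintro ⟨n, hn⟩
    refine ⟨n, ?_⟩
    have : (x : ℂ) = (n : ℂ) := by
      apply mul_left_cancel₀ h2
      rw [Complex.ofReal_one, mul_one] at hn
      rw [hn]
      ring
    exact_mod_cast this
  · rintro ⟨n, rfl⟩
    refine ⟨n, ?_⟩
    push_cast
    ring

theorem expFun_natCast (x : ℝ) (j : ℕ) : expFun x j = expFun x 1 ^ j := by
  rw [expFun, expFun, ← Complex.exp_nat_mul]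
  congr 1
  push_cast
  ring

theorem expFun_natCast_eq_one_iff (x : ℝ) (j : ℕ) :
    expFun x j = 1 ↔ ∃ n : ℤ, (j : ℝ) * x = n := by
  rw [← expFun_one_eq_one_iff, expFun, expFun]
  congr! 2
  push_cast
  ring

theorem sum_expFun_mul_sub_one (γ : ℕ) (x : ℝ) :
    (∑ j : Fin γ, expFun x (j : ℕ)) * (expFun x 1 - 1) = expFun x γ - 1 := by
  rw [Fin.sum_univ_eq_sum_range (fun j => expFun x (j : ℕ)) γ]
  simp_rw [expFun_natCast x]
  exact geom_sum_mul _ _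

/-- By the geometric sum, the mask vanishes exactly when `e^{2πix}` is a `γ`-th root of unity other
than `1`. -/
theorem digitMask_eq_zero_iff {γ : ℕ} (hγ : 1 ≤ γ) (x : ℝ) :
    digitMask γ x = 0 ↔ (∃ n : ℤ, (γ : ℝ) * x = n) ∧ ¬ ∃ n : ℤ, x = n := by
  have hγ0 : (γ : ℂ) ≠ 0 := by exact_mod_cast (by omega : γ ≠ 0)
  rw [← expFun_natCast_eq_one_iff, ← expFun_one_eq_one_iff, digitMask,
    mul_eq_zero, or_iff_right (inv_ne_zero hγ0)]
  have hmul := sum_expFun_mul_sub_one γ x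
  constructor
  · intro h0
    rw [h0, zero_mul] at hmul
    refine ⟨(sub_eq_zero.1 hmul.symm), fun h1 => hγ0 ?_⟩
    simp_rw [expFun_natCast x, h1] at h0
    simpa using h0
  · rintro ⟨h1, h2⟩
    rw [h1, sub_self] at hmul
    exact (mul_eq_zero.1 hmul).resolve_right (sub_ne_zero.2 h2)

theorem expFun_mul_left (a b x : ℝ) : expFun (a * b) x = expFun b (a * x) := by
  rw [expFun, expFun]
  congr 1
  push_cast
  ring

theorem sum_expFun_prod (γ γ' : ℕ) (x y : ℝ) :
    ((Fintype.card (Fin γ × Fin γ') : ℕ) : ℂ)⁻¹ *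
        ∑ p : Fin γ × Fin γ', expFun x (p.1 : ℕ) * expFun y (p.2 : ℕ)
      = digitMask γ x * digitMask γ' y := by
  rw [Fintype.sum_prod_type, digitMask, digitMask, Fintype.card_prod, Fintype.card_fin,
    Fintype.card_fin, Nat.cast_mul, mul_inv, mul_mul_mul_comm, Finset.sum_mul_sum]

/-! ### Two digit factors of a spectral measure -/

/-- Positions of the shifts `u j + v k` with `j < γ`, `k < γ'`. -/
noncomputable def pairShift (u v : ℝ) (γ γ' : ℕ) (p : Fin γ × Fin γ') : ℝ :=
  u * (p.1 : ℕ) + v * (p.2 : ℕ)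

section Pair

variable {u v : ℝ} {γ γ' : ℕ} {ν ρ : Measure ℝ}

/-- Distinct points of a spectrum differ by a zero of one of the factors. -/
theorem IsTranslateAverage.mask_mul_eq_zero [IsProbabilityMeasure ν] [IsProbabilityMeasure ρ]
    (hγ : 1 ≤ γ) (hγ' : 1 ≤ γ') (h : IsTranslateAverage ν ρ (pairShift u v γ γ')) {Λ : Set ℝ}
    (hΛ : IsSpectrum ν Λ) {a b : ℝ} (ha : a ∈ Λ) (hb : b ∈ Λ) (hab : a ≠ b) :
    digitMask γ (u * (b - a)) * digitMask γ' (v * (b - a)) * ∫ y, expFun (b - a) y ∂ρ = 0 := by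
  have : Nonempty (Fin γ × Fin γ') := ⟨⟨0, hγ⟩, ⟨0, hγ'⟩⟩
  obtain ⟨-, B, hB⟩ := hΛ
  have h0 : inner ℂ (B ⟨a, ha⟩) (B ⟨b, hb⟩) = 0 :=
    B.orthonormal.2 fun hne => hab (congrArg Subtype.val hne)
  have h1 : inner ℂ (B ⟨a, ha⟩) (B ⟨b, hb⟩) = ∫ x, expFun (b - a) x ∂ν := by
    rw [hB, hB, expL2, expL2, L2.inner_def]
    refine integral_congr_ae ?_
    filter_upwards [(memLp_expFun ν a).coeFn_toLp, (memLp_expFun ν b).coeFn_toLp] with x h1 h2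
    rw [h1, h2, RCLike.inner_apply, conj_expFun, ← expFun_add_left]
    rfl
  rw [h1, h.integral_eq (continuous_expFun _).measurable (fun x => (norm_expFun _ x).le)] at h0
  rw [← h0, ← sum_expFun_prod, mul_assoc, Finset.sum_mul]
  congr 1
  refine Finset.sum_congr rfl fun p _ => ?_
  rw [← integral_const_mul]
  refine integral_congr_ae (Eventually.of_forall fun y => ?_)
  simp only [expFun_add_right, pairShift, expFun_mul_left]
  ring

/-- The Parseval identity in terms of the masks of the two digit factors. -/
theorem IsTranslateAverage.tsum_mask [IsProbabilityMeasure ν] [IsProbabilityMeasure ρ]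
    (hγ : 1 ≤ γ) (hγ' : 1 ≤ γ') (hu : 0 < u) (hv : 0 < v)
    (h : IsTranslateAverage ν ρ (pairShift u v γ γ')) {Λ : Set ℝ}
    (hΛ : IsSpectrum ν Λ) {m : ℝ} (hm : ν (Set.Iio m) = 0) (θ η : ℝ) {f : ℝ → ℂ}
    (hf : Measurable f) {C : ℝ} (hC : ∀ x, ‖f x‖ ≤ C) :
    ∑' a : Λ, ‖digitMask γ (u * (θ - a)) * digitMask γ' (v * (η - a))‖ₑ ^ 2 *
        ‖∫ y, conj (expFun a y) * f y ∂ρ‖ₑ ^ 2 = ∫⁻ y, ‖f y‖ₑ ^ 2 ∂ρ := by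
  have : Nonempty (Fin γ × Fin γ') := ⟨⟨0, hγ⟩, ⟨0, hγ'⟩⟩
  have hs : ∀ p : Fin γ × Fin γ', p ≠ (⟨0, hγ⟩, ⟨0, hγ'⟩) → min u v ≤ pairShift u v γ γ' p := by
    rintro ⟨j, k⟩ hp
    rw [pairShift]
    by_cases hj : (j : ℕ) = 0
    · have hk : (1 : ℝ) ≤ ((k : ℕ) : ℝ) := by
        have : (k : ℕ) ≠ 0 := fun hk => hp (Prod.ext (Fin.ext hj) (Fin.ext hk))
        exact_mod_cast Nat.one_le_iff_ne_zero.2 this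
      have := min_le_right u v
      simp only [hj, Nat.cast_zero, mul_zero, zero_add]
      nlinarith
    · have hj : (1 : ℝ) ≤ ((j : ℕ) : ℝ) := by exact_mod_cast Nat.one_le_iff_ne_zero.2 hj
      have := min_le_left u v
      have h0 : 0 ≤ v * ((k : ℕ) : ℝ) := by positivity
      simp only
      nlinarith
  -- The coefficients are unimodular and split over the two digits, which is what allows different
  -- phases `θ` and `η`.
  have key := h.tsum_enorm_sq_eq hΛ hm (i₀ := (⟨0, hγ⟩, ⟨0, hγ'⟩)) (by simp [pairShift])
    (lt_min hu hv) hs (fun p => expFun θ (u * (p.1 : ℕ)) * expFun η (v * (p.2 : ℕ))) hf hC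
  simp only [enorm_mul, enorm_expFun, one_mul, one_pow, Finset.sum_const, Finset.card_univ,
    nsmul_eq_mul] at key
  rw [← mul_assoc, ENNReal.inv_mul_cancel (Nat.cast_ne_zero.2 Fintype.card_ne_zero)
    (ENNReal.natCast_ne_top _), one_mul] at key
  rw [← key]
  refine tsum_congr fun a => ?_
  rw [← sum_expFun_prod, enorm_mul]
  congr 4
  refine Finset.sum_congr rfl fun p _ => ?_
  rw [expFun_mul_left, expFun_mul_left, sub_eq_add_neg, sub_eq_add_neg, expFun_add_left,
    expFun_add_left, conj_expFun, pairShift, expFun_add_right]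
  ring

/-- A difference seen by the shifted mask of one factor lies in the group of zeros of that factor,
and not in that of the other factor. -/
theorem exists_int_of_mask_ne_zero {l t : ℕ} (hγ : 1 ≤ γ) (hγ' : 1 ≤ γ') (hu : 0 < u)
    (huv : u * t = v * l) (hdiv : ¬ γ ∣ t) {c : ℝ} {I : ℂ}
    (horth : c ≠ 0 → digitMask γ (u * c) * digitMask γ' (v * c) * I = 0)
    (h1 : digitMask γ (u * (c + 1 / (γ * u))) ≠ 0) (h2 : digitMask γ' (v * c) ≠ 0) (hI : I ≠ 0) :
    (∃ n : ℤ, (γ : ℝ) * (u * c) = n) ∧ ¬ ∃ n : ℤ, (γ' : ℝ) * (v * c) = n := by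
  have hγ0 : (γ : ℝ) ≠ 0 := by exact_mod_cast (by omega : γ ≠ 0)
  have hshift : u * (c + 1 / (γ * u)) = u * c + 1 / γ := by
    field_simp
  rw [hshift] at h1
  -- At `c = 0` the shifted mask is taken at `1 / γ`, a zero unless `γ = 1`, and `γ = 1` would
  -- divide `t`.
  have hc : c ≠ 0 := by
    rintro rfl
    refine h1 ((digitMask_eq_zero_iff hγ _).2 ⟨⟨1, ?_⟩, ?_⟩)
    · field_simp
      simp
    · rintro ⟨n, hn⟩
      have h3 : (1 : ℝ) = γ * n := by
        rw [← hn]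
        field_simp
        simp
      have h4 : (1 : ℤ) = γ * n := by exact_mod_cast h3
      have h5 : (γ : ℤ) ∣ 1 := ⟨n, h4⟩
      exact hdiv ((by exact_mod_cast h5 : γ ∣ 1).trans (one_dvd t))
  have h3 : digitMask γ (u * c) = 0 := by
    by_contra hne
    exact mul_ne_zero (mul_ne_zero hne h2) hI (horth hc)
  obtain ⟨⟨n, hn⟩, -⟩ := (digitMask_eq_zero_iff hγ _).1 h3
  refine ⟨⟨n, hn⟩, fun hex => ?_⟩
  -- If `γ' v c` were an integer, nonvanishing of the masks would make both `v c` and `u c + 1 / γ`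
  -- integers; then `u t = v l` yields `γ ∣ t`.
  obtain ⟨q, hq⟩ : ∃ q : ℤ, v * c = q := by
    by_contra hne
    exact h2 ((digitMask_eq_zero_iff hγ' _).2 ⟨hex, hne⟩)
  obtain ⟨r, hr⟩ : ∃ r : ℤ, u * c + 1 / γ = r := by
    by_contra hne
    refine h1 ((digitMask_eq_zero_iff hγ _).2 ⟨⟨n + 1, ?_⟩, hne⟩)
    rw [mul_add, hn]
    field_simp
    push_cast
    ring
  have h4 : (t : ℝ) = γ * (t * r - l * q) := by
    rw [← hr, ← hq]
    have : u * c * t = v * c * l := by linear_combination c * huv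
    field_simp
    linear_combination (-γ : ℝ) * this
  have h5 : (t : ℤ) = γ * (t * r - l * q) := by exact_mod_cast h4
  have h6 : (γ : ℤ) ∣ t := ⟨_, h5⟩
  exact hdiv (by exact_mod_cast h6)

/-- Two digit factors of a spectral convolution: one of the two divisibility relations holds. -/
theorem IsTranslateAverage.dvd_of_spectrum [IsProbabilityMeasure ν] [IsProbabilityMeasure ρ]
    {l t : ℕ} (hγ : 1 ≤ γ) (hγ' : 1 ≤ γ') (hu : 0 < u) (hv : 0 < v) (huv : u * t = v * l)
    (h : IsTranslateAverage ν ρ (pairShift u v γ γ')) {Λ : Set ℝ} (hΛ : IsSpectrum ν Λ)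
    {m : ℝ} (hm : ν (Set.Iio m) = 0) (hdiv : ¬ γ ∣ t) : γ' ∣ l := by
  by_contra hdiv'
  have horth : ∀ {a b : ℝ}, a ∈ Λ → b ∈ Λ → b - a ≠ 0 →
      digitMask γ (u * (b - a)) * digitMask γ' (v * (b - a)) * ∫ y, expFun (b - a) y ∂ρ = 0 :=
    fun ha hb hab => h.mask_mul_eq_zero hγ hγ' hΛ ha hb fun e => hab (by rw [e, sub_self])
  have hint : ∀ a b : ℝ, ∫ y, conj (expFun a y) * expFun b y ∂ρ = ∫ y, expFun (b - a) y ∂ρ := by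
    intro a b
    refine integral_congr_ae (Eventually.of_forall fun y => ?_)
    simp only [conj_expFun, ← expFun_add_left]
    congr 1
    ring
  have hP : ∀ θ η b : ℝ, ∑' a : Λ,
      ‖digitMask γ (u * (θ - a)) * digitMask γ' (v * (η - a))‖ₑ ^ 2 *
        ‖∫ y, expFun (b - a) y ∂ρ‖ₑ ^ 2 = 1 := by
    intro θ η b
    have := h.tsum_mask hγ hγ' hu hv hΛ hm θ η (continuous_expFun b).measurable
      (fun x => (norm_expFun b x).le)
    simpa [hint, enorm_expFun] using this
  obtain ⟨⟨a₀, ha₀⟩, -⟩ := ENNReal.summable.tsum_ne_zero_iff.1 (by rw [hP 0 0 0]; simp)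
  -- The shift `1 / (γ' v)` moves the second mask by `1 / γ'`, so a contributing `b` differs from
  -- `a₀` by a zero of the second factor.
  obtain ⟨⟨b, hb⟩, hbne⟩ := ENNReal.summable.tsum_ne_zero_iff.1
    (by rw [hP a₀ (a₀ + 1 / (γ' * v)) a₀]; simp)
  simp only [ne_eq, mul_eq_zero, pow_eq_zero_iff, OfNat.ofNat_ne_zero, not_false_eq_true,
    enorm_eq_zero, not_or] at hbne
  obtain ⟨⟨hb1, hb2⟩, hb3⟩ := hbne
  obtain ⟨hbint, hbnot⟩ := exists_int_of_mask_ne_zero (c := a₀ - b) hγ' hγ hv huv.symm hdiv'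
    (fun hc => by rw [mul_comm (digitMask γ' _)]; exact horth hb ha₀ hc)
    (by convert hb2 using 3; ring) hb1 hb3
  set z := ∫ y, expFun (a₀ - b) y ∂ρ with hz
  -- This is `e_{a₀}` minus its projection onto `e_b` in `L²(ρ)`.
  set f : ℝ → ℂ := fun y => expFun a₀ y - z * expFun b y with hf
  have hfm : Measurable f := ((continuous_expFun a₀).sub
    (continuous_const.mul (continuous_expFun b))).measurable
  have hfC : ∀ y, ‖f y‖ ≤ 1 + ‖z‖ := fun y => by
    refine (norm_sub_le _ _).trans ?_
    rw [norm_mul, norm_expFun, norm_expFun, mul_one]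
  have hie : ∀ c, Integrable (expFun c) ρ := fun c =>
    Integrable.of_bound (continuous_expFun c).aestronglyMeasurable 1
      (Eventually.of_forall fun x => (norm_expFun c x).le)
  have hge : 1 ≤ ∫⁻ y, ‖f y‖ₑ ^ 2 ∂ρ := by
    rw [← h.tsum_mask hγ hγ' hu hv hΛ hm (a₀ + 1 / (γ * u)) a₀ hfm hfC,
      ← hP (a₀ + 1 / (γ * u)) a₀ a₀]
    -- Termwise comparison: wherever the term for `e_{a₀}` is nonzero, `e_a` is orthogonal to `e_b`
    -- in `L²(ρ)`, so `f` has the same coefficient there.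
    refine ENNReal.tsum_le_tsum fun ⟨a, ha⟩ => ?_
    by_cases h0 : digitMask γ (u * (a₀ + 1 / (γ * u) - a)) ≠ 0 ∧ digitMask γ' (v * (a₀ - a)) ≠ 0 ∧
        ∫ y, expFun (a₀ - a) y ∂ρ ≠ 0
    · obtain ⟨h1, h2, h3⟩ := h0
      obtain ⟨haint, hanot⟩ := exists_int_of_mask_ne_zero (c := a₀ - a) hγ hγ' hu huv hdiv
        (fun hc => horth ha ha₀ hc) (by convert h1 using 3; ring) h2 h3
      -- As `b - a = (a₀ - a) - (a₀ - b)`, with each difference in exactly one of the two groups and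
      -- not the same one, `b - a` is in neither.
      have h4 : ¬ ∃ n : ℤ, (γ : ℝ) * (u * (b - a)) = n := by
        rintro ⟨n, hn⟩
        obtain ⟨k, hk⟩ := haint
        refine hbnot ⟨k - n, ?_⟩
        push_cast
        linear_combination hk - hn
      have h5 : ¬ ∃ n : ℤ, (γ' : ℝ) * (v * (b - a)) = n := by
        rintro ⟨n, hn⟩
        obtain ⟨k, hk⟩ := hbint
        refine hanot ⟨k + n, ?_⟩
        push_cast
        linear_combination hk + hn
      have h6 : ∫ y, expFun (b - a) y ∂ρ = 0 := by
        by_contra hne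
        refine mul_ne_zero (mul_ne_zero (fun e => h4 ((digitMask_eq_zero_iff hγ _).1 e).1)
          (fun e => h5 ((digitMask_eq_zero_iff hγ' _).1 e).1)) hne (horth ha hb fun e => h4 ⟨0, ?_⟩)
        rw [e]
        simp
      have h7 : ∫ y, conj (expFun a y) * f y ∂ρ = ∫ y, expFun (a₀ - a) y ∂ρ := by
        have e : ∀ y, conj (expFun a y) * f y = expFun (a₀ - a) y - z * expFun (b - a) y := by
          intro y
          simp only [hf, conj_expFun, sub_eq_add_neg _ a, expFun_add_left]
          ring
        simp_rw [e]
        rw [integral_sub (hie _) ((hie _).const_mul _), integral_const_mul, h6, mul_zero, sub_zero]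
      rw [h7]
    · refine le_of_eq_of_le ?_ zero_le
      simp only [mul_eq_zero, pow_eq_zero_iff, ne_eq, OfNat.ofNat_ne_zero, not_false_eq_true,
        enorm_eq_zero]
      tauto
  have hnorm : ∀ y, ‖f y‖ ^ 2 = 1 + ‖z‖ ^ 2 - 2 * (conj z * expFun (a₀ - b) y).re := by
    intro y
    have e : expFun a₀ y * conj (z * expFun b y) = conj z * expFun (a₀ - b) y := by
      rw [map_mul, conj_expFun, sub_eq_add_neg, expFun_add_left]
      ring
    rw [hf, ← Complex.normSq_eq_norm_sq, Complex.normSq_sub, e, Complex.normSq_eq_norm_sq,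
      Complex.normSq_eq_norm_sq, norm_mul, norm_expFun, norm_expFun]
    ring
  have hint2 : Integrable (fun y => (conj z * expFun (a₀ - b) y).re) ρ :=
    ((hie _).const_mul _).re
  have hval : ∫ y, ‖f y‖ ^ 2 ∂ρ = 1 - ‖z‖ ^ 2 := by
    simp_rw [hnorm]
    rw [integral_sub (integrable_const _) (hint2.const_mul 2), integral_const, integral_const_mul]
    have e : ∫ y, (conj z * expFun (a₀ - b) y).re ∂ρ = ‖z‖ ^ 2 := by
      have := integral_re ((hie (a₀ - b)).const_mul (conj z))
      simp only [RCLike.re_eq_complex_re] at this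
      rw [this, integral_const_mul, ← hz, mul_comm, Complex.mul_conj, Complex.ofReal_re,
        Complex.normSq_eq_norm_sq]
    rw [e]
    simp
    ring
  have hlt : ∫⁻ y, ‖f y‖ₑ ^ 2 ∂ρ = ENNReal.ofReal (1 - ‖z‖ ^ 2) := by
    rw [← hval, ofReal_integral_eq_lintegral_ofReal]
    · refine lintegral_congr fun y => ?_
      rw [ENNReal.ofReal_pow (norm_nonneg _), ofReal_norm]
    · simp_rw [hnorm]
      exact (integrable_const _).sub (hint2.const_mul 2)
    · exact Eventually.of_forall fun y => by positivity
  rw [hlt, ENNReal.one_le_ofReal] at hge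
  have : 0 < ‖z‖ := norm_pos_iff.2 hb3
  nlinarith

end Pair

/-! ### Splitting two factors off an infinite convolution -/

theorem finsetSum_conv {ι : Type*} (s : Finset ι) (f : ι → Measure ℝ) [∀ i, IsFiniteMeasure (f i)]
    (R : Measure ℝ) [SFinite R] :
    Measure.conv (∑ i ∈ s, f i) R = ∑ i ∈ s, Measure.conv (f i) R := by
  classical
  induction s using Finset.induction_on with
  | empty => simp
  | insert a s ha ih => rw [Finset.sum_insert ha, Finset.sum_insert ha, Measure.add_conv, ih]

theorem uniformDirac_image {u : ℝ} (hu : u ≠ 0) (γ : ℕ) :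
    uniformDirac ((Finset.range γ).image fun j : ℕ => u * (j : ℝ))
      = (γ : ℝ≥0∞)⁻¹ • ∑ j : Fin γ, Measure.dirac (u * (j : ℕ)) := by
  have hinj : Function.Injective fun j : ℕ => u * (j : ℝ) := fun a b hab => by
    exact_mod_cast mul_left_cancel₀ hu hab
  rw [uniformDirac, Finset.card_image_of_injective _ hinj, Finset.card_range,
    Finset.sum_image hinj.injOn, Fin.sum_univ_eq_sum_range (fun j => Measure.dirac (u * (j : ℝ))) γ]

theorem isProbabilityMeasure_uniformDirac {A : Finset ℝ} (hA : A.Nonempty) :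
    IsProbabilityMeasure (uniformDirac A) := by
  refine ⟨?_⟩
  rw [uniformDirac, Measure.smul_apply, Measure.finsetSum_apply]
  simp only [measure_univ, Finset.sum_const, nsmul_eq_mul, mul_one, smul_eq_mul]
  exact ENNReal.inv_mul_cancel (by simpa using hA.ne_empty) (ENNReal.natCast_ne_top _)

/-- Convolving with two digit measures averages the translates. -/
theorem isTranslateAverage_conv {u v : ℝ} (hu : u ≠ 0) (hv : v ≠ 0) (γ γ' : ℕ)
    (R : Measure ℝ) [SFinite R] :
    IsTranslateAverage
      (Measure.conv (Measure.conv
        (uniformDirac ((Finset.range γ).image fun j : ℕ => u * (j : ℝ)))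
        (uniformDirac ((Finset.range γ').image fun j : ℕ => v * (j : ℝ)))) R)
      R (pairShift u v γ γ') := by
  rw [uniformDirac_image hu, uniformDirac_image hv, IsTranslateAverage, Measure.conv_smul_left,
    Measure.conv_smul_right, Measure.conv_smul_left, Measure.conv_smul_left, smul_smul,
    Fintype.card_prod, Fintype.card_fin, Fintype.card_fin, Nat.cast_mul,
    ENNReal.mul_inv (Or.inr (ENNReal.natCast_ne_top _)) (Or.inl (ENNReal.natCast_ne_top _)),
    Fintype.sum_prod_type, finsetSum_conv, finsetSum_conv]
  congr 1
  refine Finset.sum_congr rfl fun j _ => ?_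
  rw [Measure.conv_comm (Measure.dirac _), finsetSum_conv, finsetSum_conv]
  refine Finset.sum_congr rfl fun k _ => ?_
  rw [Measure.dirac_conv_dirac, Measure.dirac_conv]
  congr 1
  ext y
  simp only [pairShift]
  ring

theorem isProbabilityMeasure_finiteConv (μ : ℕ → Measure ℝ) [∀ k, IsProbabilityMeasure (μ k)]
    (n : ℕ) : IsProbabilityMeasure (finiteConv μ n) := by
  induction n with
  | zero => rw [finiteConv]; infer_instance
  | succ n ih => rw [finiteConv]; infer_instance

theorem charFun_finiteConv (μ : ℕ → Measure ℝ) [∀ k, IsProbabilityMeasure (μ k)] (n : ℕ) (x : ℝ) :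
    charFun (finiteConv μ n) x = ∏ k ∈ Finset.range n, charFun (μ k) x := by
  induction n with
  | zero => simp [finiteConv]
  | succ n ih =>
    have := isProbabilityMeasure_finiteConv μ n
    rw [finiteConv, charFun_conv, ih, Finset.prod_range_succ]

/-- Two factors can be moved to the front of a finite convolution. -/
theorem finiteConv_eq_conv_update (μ : ℕ → Measure ℝ) [∀ k, IsProbabilityMeasure (μ k)]
    {i j n : ℕ} (hij : i ≠ j) (hi : i < n) (hj : j < n) :
    ∃ R : Measure ℝ, IsProbabilityMeasure R ∧
      finiteConv μ n = Measure.conv (Measure.conv (μ i) (μ j)) R := by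
  -- The cofactor is the same convolution with the two chosen factors replaced by the unit `δ_0`.
  set μ' : ℕ → Measure ℝ := fun k => if k = i ∨ k = j then Measure.dirac 0 else μ k with hμ'
  have hprob : ∀ k, IsProbabilityMeasure (μ' k) := fun k => by
    simp only [hμ']
    split_ifs <;> infer_instance
  have h1 := isProbabilityMeasure_finiteConv μ n
  have h2 := isProbabilityMeasure_finiteConv μ' n
  refine ⟨finiteConv μ' n, h2, Measure.ext_of_charFun ?_⟩
  ext x
  rw [charFun_conv, charFun_conv, charFun_finiteConv, charFun_finiteConv]
  have hi' : i ∈ Finset.range n := Finset.mem_range.2 hi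
  have hj' : j ∈ (Finset.range n).erase i := Finset.mem_erase.2 ⟨hij.symm, Finset.mem_range.2 hj⟩
  rw [← Finset.mul_prod_erase _ _ hi', ← Finset.mul_prod_erase _ _ hj',
    ← Finset.mul_prod_erase _ _ hi', ← Finset.mul_prod_erase _ _ hj']
  have h3 : charFun (μ' i) x = 1 := by simp [hμ']
  have h4 : charFun (μ' j) x = 1 := by simp [hμ']
  rw [h3, h4, one_mul, one_mul, ← mul_assoc]
  congr 1
  refine Finset.prod_congr rfl fun k hk => ?_
  simp only [Finset.mem_erase] at hk
  simp [hμ', hk.1, hk.2.1]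

/-- A weak limit of convolutions with a fixed factor `κ` is a convolution with `κ`, provided that
`κ` has an atom at the origin. -/
theorem exists_eq_conv_of_tendsto {κ ν : Measure ℝ} [IsProbabilityMeasure κ]
    [IsProbabilityMeasure ν] {c : ℝ≥0∞} (hc : c ≠ ∞)
    (hκ : ∀ R : Measure ℝ, IsProbabilityMeasure R → R ≤ c • Measure.conv κ R)
    (R : ℕ → ProbabilityMeasure ℝ)
    (hR : ∀ x, Tendsto (fun n => charFun (Measure.conv κ (R n)) x) atTop (𝓝 (charFun ν x))) :
    ∃ ρ : Measure ℝ, IsProbabilityMeasure ρ ∧ ν = Measure.conv κ ρ := by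
  have htight : IsTightMeasureSet (Set.range fun n => Measure.conv κ (R n : Measure ℝ)) :=
    isTightMeasureSet_of_tendsto_charFun (f := charFun ν) (by fun_prop) hR
  have htightR : IsTightMeasureSet
      {((μ : ProbabilityMeasure ℝ) : Measure ℝ) | μ ∈ Set.range R} := by
    rw [isTightMeasureSet_iff_exists_isCompact_measure_compl_le] at htight ⊢
    intro ε hε
    -- Using `c + 1` in place of `c` keeps the divisor nonzero.
    have hc1 : c + 1 ≠ 0 := by simp
    obtain ⟨K, hK, hle⟩ := htight (ε / (c + 1))
      (ENNReal.div_pos hε.ne' (by simpa using hc))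
    refine ⟨K, hK, ?_⟩
    rintro _ ⟨_, ⟨n, rfl⟩, rfl⟩
    calc (R n : Measure ℝ) Kᶜ ≤ (c • Measure.conv κ (R n : Measure ℝ)) Kᶜ := hκ _ inferInstance _
      _ = c * Measure.conv κ (R n : Measure ℝ) Kᶜ := by simp
      _ ≤ (c + 1) * (ε / (c + 1)) := mul_le_mul' le_self_add (hle _ ⟨n, rfl⟩)
      _ ≤ ε := ENNReal.mul_div_le
  have hcomp := isCompact_closure_of_isTightMeasureSet htightR
  -- A limit of the cofactors along one ultrafilter is enough, since the characteristic functions of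
  -- the convolutions converge along the whole sequence.
  set U : Ultrafilter ℕ := Ultrafilter.of atTop with hU
  obtain ⟨ρ, -, hρ⟩ := hcomp.ultrafilter_le_nhds (U.map R) (by
    rw [le_principal_iff]
    exact Filter.mem_map.2 (Eventually.of_forall fun n => subset_closure ⟨n, rfl⟩))
  have hρ' : Tendsto R U (𝓝 ρ) := hρ
  refine ⟨ρ, inferInstance, Measure.ext_of_charFun ?_⟩
  ext x
  have h1 : Tendsto (fun n => charFun (R n : Measure ℝ) x) U (𝓝 (charFun (ρ : Measure ℝ) x)) := by
    rw [ProbabilityMeasure.tendsto_iff_forall_integral_rclike_tendsto ℂ] at hρ'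
    simp_rw [charFun_eq_integral_innerProbChar]
    exact hρ' _
  have h2 := (hR x).mono_left (Ultrafilter.of_le atTop)
  simp_rw [charFun_conv] at h2
  rw [charFun_conv]
  exact tendsto_nhds_unique h2 (h1.const_mul _)

/-- An infinite convolution of measures is the convolution of any two of its digit factors with a
probability measure. -/
theorem IsMoranMeasure.exists_isTranslateAverage {d : ℕ → ℚ} {γ : ℕ → ℕ} {ν : Measure ℝ}
    (hd : ∀ k, 0 < d k) (hγ : ∀ k, 1 ≤ γ k) (hν : IsMoranMeasure d γ ν) {i j : ℕ} (hij : i ≠ j) :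
    ∃ ρ : Measure ℝ, IsProbabilityMeasure ρ ∧ IsTranslateAverage ν ρ
      (pairShift (∏ m ∈ Finset.range (i + 1), (d m : ℝ))⁻¹
        (∏ m ∈ Finset.range (j + 1), (d m : ℝ))⁻¹ (γ i) (γ j)) := by
  obtain ⟨hprob, hlim⟩ := hν
  set μ : ℕ → Measure ℝ := fun k => uniformDirac (moranDigits d γ k) with hμ
  have hne : ∀ k, (∏ m ∈ Finset.range (k + 1), (d m : ℝ))⁻¹ ≠ 0 := fun k =>
    inv_ne_zero (Finset.prod_ne_zero_iff.2 fun m _ => by exact_mod_cast (hd m).ne')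
  have hμp : ∀ k, IsProbabilityMeasure (μ k) := fun k =>
    isProbabilityMeasure_uniformDirac
      ((Finset.nonempty_range_iff.2 (by have := hγ k; omega)).image _)
  have havg : ∀ (R : Measure ℝ) [SFinite R], IsTranslateAverage
      (Measure.conv (Measure.conv (μ i) (μ j)) R) R _ := fun R _ =>
    isTranslateAverage_conv (hne i) (hne j) (γ i) (γ j) R
  have hN : Nonempty (Fin (γ i) × Fin (γ j)) := ⟨⟨0, hγ i⟩, ⟨0, hγ j⟩⟩
  -- The offset `i + j + 1` ensures that both factors occur in every finite convolution considered.
  choose R hRp hR using fun n : ℕ => finiteConv_eq_conv_update μ (n := n + (i + j + 1)) hij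
    (by omega) (by omega)
  have hweak : ∀ x, Tendsto (fun n => charFun (finiteConv μ n) x) atTop (𝓝 (charFun ν x)) := by
    have hF := isProbabilityMeasure_finiteConv μ
    let F : ℕ → ProbabilityMeasure ℝ := fun n => ⟨finiteConv μ n, hF n⟩
    let ν' : ProbabilityMeasure ℝ := ⟨ν, hprob⟩
    have : Tendsto F atTop (𝓝 ν') :=
      ProbabilityMeasure.tendsto_iff_forall_integral_tendsto.2 hlim
    exact ProbabilityMeasure.tendsto_iff_tendsto_charFun.1 this
  obtain ⟨ρ, hρ, hνρ⟩ := exists_eq_conv_of_tendsto (κ := Measure.conv (μ i) (μ j)) (ν := ν)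
    (c := (Fintype.card (Fin (γ i) × Fin (γ j)) : ℝ≥0∞)) (ENNReal.natCast_ne_top _)
    (fun R _ => by
      -- The digit pair `(0, 0)` has shift zero, so `R` itself is one of the averaged translates.
      have := (havg R).map_le (⟨0, hγ i⟩, ⟨0, hγ j⟩)
      simpa [pairShift] using this)
    (fun n => ⟨R n, hRp n⟩) (fun x => by
      have := (hweak x).comp (tendsto_add_atTop_nat (i + j + 1))
      refine this.congr fun n => ?_
      exact congrArg (fun m => charFun m x) (hR n))
  refine ⟨ρ, hρ, ?_⟩
  rw [hνρ]
  exact havg ρ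

/-! ### Divisibility for spectral Moran measures -/

/-- For two digit factors of a spectral Moran measure whose scales have quotient `l / t`, one of the
two divisibility relations holds. -/
theorem IsMoranMeasure.dvd_of_isSpectralMeasure {d : ℕ → ℚ} {γ : ℕ → ℕ} {ν : Measure ℝ}
    (hd : ∀ k, 0 < d k) (hγ : ∀ k, 1 ≤ γ k) (hν : IsMoranMeasure d γ ν)
    (hspec : IsSpectralMeasure ν) {i j : ℕ} (hij : i ≠ j) {l t : ℕ}
    (hlt : (∏ m ∈ Finset.range (j + 1), d m) * t = (∏ m ∈ Finset.range (i + 1), d m) * l)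
    (hdiv : ¬ γ i ∣ t) : γ j ∣ l := by
  obtain ⟨hprob, hcomp, Λ, hΛ⟩ := hspec
  obtain ⟨ρ, hρ, havg⟩ := hν.exists_isTranslateAverage hd hγ hij
  have hpos : ∀ k, 0 < ∏ m ∈ Finset.range (k + 1), (d m : ℝ) := fun k =>
    Finset.prod_pos fun m _ => by exact_mod_cast hd m
  obtain ⟨m, hm⟩ := hcomp.bddBelow
  have hm' : ν (Set.Iio m) = 0 := by
    have hsub : Set.Iio m ⊆ ν.supportᶜ := fun x hx hmem => not_le.2 hx (hm hmem)
    exact measure_mono_null hsub Measure.measure_compl_support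
  refine havg.dvd_of_spectrum (hγ i) (hγ j) (inv_pos.2 (hpos i)) (inv_pos.2 (hpos j)) ?_ hΛ hm' hdiv
  have h1 : (∏ m ∈ Finset.range (j + 1), (d m : ℝ)) * t
      = (∏ m ∈ Finset.range (i + 1), (d m : ℝ)) * l := by exact_mod_cast hlt
  have h2 := (hpos i).ne'
  have h3 := (hpos j).ne'
  field_simp
  linear_combination h1

theorem proposition5p3 (d : ℕ → ℚ) (l t γ : ℕ → ℕ)
    (hl : ∀ k, 1 ≤ l k) (ht : ∀ k, 1 ≤ t k) (hγ : ∀ k, 1 ≤ γ k)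
    (hd : ∀ k, d k = (l k : ℚ) / (t k : ℚ))
    (ht_bdd : BddAbove (Set.range t)) (hγ_bdd : BddAbove (Set.range γ))
    (ν : Measure ℝ) (hν : IsMoranMeasure d γ ν) (hspec : IsSpectralMeasure ν) :
    (∀ i, ¬ γ i ∣ t (i + 1) → γ (i + 1) ∣ l (i + 1)) ∧
    (∀ i, ¬ γ i ∣ t (i + 1) → 2 ≤ γ (i + 1) → Nat.gcd (l (i + 1)) (t (i + 1)) = 1 →
      d (i + 2) = (l (i + 2) : ℚ) → t (i + 1) ∣ l (i + 2) →
      t (i + 1) * γ (i + 2) ∣ l (i + 2)) := by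
  have ht0 : ∀ k, (t k : ℚ) ≠ 0 := fun k => by
    have := ht k
    exact_mod_cast (by omega : t k ≠ 0)
  have hdpos : ∀ k, 0 < d k := fun k => by
    have h1 := hl k
    have h2 := ht k
    rw [hd]
    positivity
  have hstep : ∀ k, d k * t k = l k := fun k => by rw [hd, div_mul_cancel₀ _ (ht0 k)]
  refine ⟨fun i hi => ?_, fun i hi h2 hgcd hint hdvd => ?_⟩
  · refine hν.dvd_of_isSpectralMeasure hdpos hγ hspec (Nat.ne_of_lt (Nat.lt_succ_self i)) ?_ hi
    rw [Finset.prod_range_succ _ (i + 1), mul_assoc, hstep]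
  · have hγi : ¬ γ i ∣ 1 := fun h => hi (h.trans (one_dvd _))
    have hγi' : ¬ γ (i + 1) ∣ 1 := fun h => by
      have := Nat.le_of_dvd one_pos h
      omega
    obtain ⟨m, hm⟩ := hdvd
    -- Factors `i + 1` and `i + 2`: the scale quotient is the integer `l (i + 2) = t (i + 1) * m`,
    -- so `t = 1`.
    have hA : γ (i + 2) ∣ t (i + 1) * m := by
      refine hν.dvd_of_isSpectralMeasure hdpos hγ hspec (i := i + 1) (by omega) ?_ hγi'
      rw [Finset.prod_range_succ _ (i + 2), hint, hm]
      push_cast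
      ring
    -- Factors `i` and `i + 2`: in the quotient `d (i + 1) * d (i + 2)` the denominator `t (i + 1)`
    -- cancels, so again `t = 1`.
    have hB : γ (i + 2) ∣ l (i + 1) * m := by
      refine hν.dvd_of_isSpectralMeasure hdpos hγ hspec (i := i) (by omega) ?_ hγi
      rw [Finset.prod_range_succ _ (i + 2), Finset.prod_range_succ _ (i + 1), hint, hm]
      push_cast
      linear_combination (∏ x ∈ Finset.range (i + 1), d x) * m * hstep (i + 1)
    rw [hm]
    refine mul_dvd_mul_left _ ?_
    have := Nat.dvd_gcd hA hB
    rwa [Nat.gcd_mul_right, Nat.gcd_comm, hgcd, one_mul] at this
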